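/- Let $n\ge 1$, equip $\mathbb R^{n+1}$ with $\langle x,y\rangle=-x_0y_0+x_1y_1+\cdots+x_ny_n$, and let $M=I^n=\{x:\langle x,x\rangle=-1,\ x_0>0\}$ be the hyperboloid model of hyperbolic $n$-space, with distance $d_M$ given by $\cosh d_M(x,y)=-\langle x,y\rangle$. Let $O(n,1)$ be the group of real matrices preserving $\langle\cdot,\cdot\rangle$; $g\in O(n,1)$ acts on $M$ by sending $x$ to whichever of $gx,-gx$ lies in $M$. Let $G$ be $SO(n,1)=\{g\in O(n,1):\det g=1\}$ (or its identity component $SO_0(n,1)$, or the full isometry group $O^+(n,1)$ of $M$, consisting of the elements of $O(n,1)$ that preserve $M$), with the topology induced from matrices. Fix any $o\in M$ and put $$K(g,h)=d_M(go,ho)\qquad(g,h\in G).$$ 1. $K(g,h)=d_M(o,g^{-1}ho)$, and $K$ is a conditionally negative kernel on the group $G$: $K(gh,gk)=K(h,k)$ for all $g,h,k\in G$, and $\sum_{i,j}\lambda_i\lambda_jK(g_i,g_j)\le 0$ for all finite sets $\{g_1,\dots,g_m\}\subset G$ and all $\lambda_1,\dots,\lambda_m\in\mathbb R$ with $\sum_i\lambda_i=0$.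 2. There is a unit-speed geodesic line $p:\mathbb R\to M$ with $p_0=o$ (that is, $d_M(p_s,p_t)=|s-t|$ for all $s,t\in\mathbb R$), and for every such line there is a continuous one-parameter subgroup $(a_t)_{t\in\mathbb R}$ of $G$ of hyperbolic translations along $p$, i.e. $a_tp_s=p_{s+t}$ for all $s,t$ and $a_t$ is the identity on the orthogonal complement of the span of $p$, such that $K(a_t,e)=|t|$ for all $t$; in particular $K(a_t,e)\to\infty$ as $t\to\infty$. Hence $K$ is unbounded on $G\times G$. 3. The topological group $G$ does not have Kazhdan's property (T): there are no compact set $Q\subset G$ and $\varepsilon>0$ such that every strongly continuous unitary representation $\pi$ of $G$ on a complex Hilbert space which has a vector $\xi\ne0$ with $\|\pi(q)\xi-\xi\|<\varepsilon\|\xi\|$ for all $q\in Q$ has a nonzero $G$-invariant vector. -/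

import Mathlib

open Filter Topology
open scoped Matrix

/-- The Lorentzian bilinear form `⟨x, y⟩ = -x₀ y₀ + x₁ y₁ + ⋯ + xₙ yₙ` on `ℝⁿ⁺¹`. -/
def lorentzForm {n : ℕ} (x y : Fin (n + 1) → ℝ) : ℝ :=
  -(x 0 * y 0) + ∑ i : Fin n, x i.succ * y i.succ

theorem lorentzForm_neg_neg {n : ℕ} (x y : Fin (n + 1) → ℝ) :
    lorentzForm (-x) (-y) = lorentzForm x y := by
  simp [lorentzForm]

theorem lorentz_time_ne_zero {n : ℕ} {x : Fin (n + 1) → ℝ} (hx : lorentzForm x x = -1) :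
    x 0 ≠ 0 := by
  intro h
  have h1 : 0 ≤ ∑ i : Fin n, x i.succ * x i.succ :=
    Finset.sum_nonneg fun i _ => mul_self_nonneg _
  simp only [lorentzForm, h] at hx
  linarith

/-- The hyperboloid model `Iⁿ` of hyperbolic `n`-space. -/
def Hyperboloid (n : ℕ) : Type :=
  {x : Fin (n + 1) → ℝ // lorentzForm x x = -1 ∧ 0 < x 0}

/-- The hyperbolic distance on the hyperboloid model: `cosh d(x, y) = -⟨x, y⟩`. -/
noncomputable def hypDist {n : ℕ} (x y : Hyperboloid n) : ℝ :=
  Real.arcosh (-(lorentzForm x.1 y.1))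

/-- `O(n,1)`: the invertible real matrices preserving the Lorentzian form. -/
def lorentzO (n : ℕ) : Subgroup (GL (Fin (n + 1)) ℝ) where
  carrier := {g | ∀ x y : Fin (n + 1) → ℝ,
    lorentzForm ((g : Matrix (Fin (n + 1)) (Fin (n + 1)) ℝ) *ᵥ x)
      ((g : Matrix (Fin (n + 1)) (Fin (n + 1)) ℝ) *ᵥ y) = lorentzForm x y}
  one_mem' := by
    intro x y
    simp
  mul_mem' := by
    intro a b ha hb x y
    rw [Units.val_mul, ← Matrix.mulVec_mulVec, ← Matrix.mulVec_mulVec, ha, hb]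
  inv_mem' := by
    intro a ha x y
    rw [← ha]
    simp only [Matrix.mulVec_mulVec, ← Units.val_mul, mul_inv_cancel, Units.val_one,
      Matrix.one_mulVec]

/-- The linear action of `g ∈ O(n,1)` on `ℝⁿ⁺¹`. -/
def linAct {n : ℕ} (g : lorentzO n) (x : Fin (n + 1) → ℝ) : Fin (n + 1) → ℝ :=
  ((g : GL (Fin (n + 1)) ℝ) : Matrix (Fin (n + 1)) (Fin (n + 1)) ℝ) *ᵥ x

theorem lorentzForm_linAct {n : ℕ} (g : lorentzO n) (x y : Fin (n + 1) → ℝ) :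
    lorentzForm (linAct g x) (linAct g y) = lorentzForm x y := g.2 x y

theorem linAct_one {n : ℕ} (x : Fin (n + 1) → ℝ) : linAct (1 : lorentzO n) x = x := by
  simp [linAct]

theorem linAct_mul {n : ℕ} (g h : lorentzO n) (x : Fin (n + 1) → ℝ) :
    linAct (g * h) x = linAct g (linAct h x) := by
  simp [linAct, Matrix.mulVec_mulVec]

theorem linAct_neg {n : ℕ} (g : lorentzO n) (x : Fin (n + 1) → ℝ) :
    linAct g (-x) = -linAct g x := by
  simp [linAct, Matrix.mulVec_neg]

/-- The representative with positive time coordinate among `v` and `-v`. -/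
noncomputable def toUpper {n : ℕ} (v : Fin (n + 1) → ℝ) : Fin (n + 1) → ℝ :=
  if 0 < v 0 then v else -v

theorem toUpper_neg {n : ℕ} {v : Fin (n + 1) → ℝ} (hv : v 0 ≠ 0) :
    toUpper (-v) = toUpper v := by
  unfold toUpper
  rcases lt_or_gt_of_ne hv with h | h
  · rw [if_pos (by simpa using h), if_neg (by linarith)]
  · rw [if_neg (by simp only [Pi.neg_apply]; linarith), if_pos h, neg_neg]

theorem toUpper_mem {n : ℕ} {v : Fin (n + 1) → ℝ} (hv : lorentzForm v v = -1) :
    lorentzForm (toUpper v) (toUpper v) = -1 ∧ 0 < toUpper v 0 := by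
  unfold toUpper
  split_ifs with h
  · exact ⟨hv, h⟩
  · refine ⟨by rw [lorentzForm_neg_neg, hv], ?_⟩
    have := lt_of_le_of_ne (not_lt.mp h) (lorentz_time_ne_zero hv)
    simpa using this

theorem toUpper_linAct_toUpper {n : ℕ} (g : lorentzO n) {v : Fin (n + 1) → ℝ}
    (hv : lorentzForm v v = -1) : toUpper (linAct g (toUpper v)) = toUpper (linAct g v) := by
  by_cases h : 0 < v 0
  · have : toUpper v = v := if_pos h
    rw [this]
  · have : toUpper v = -v := if_neg h
    rw [this, linAct_neg, toUpper_neg]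
    exact lorentz_time_ne_zero (by rw [lorentzForm_linAct, hv])

/-- `O(n,1)` acts on hyperbolic space, regarded as the set of negative lines of `ℝⁿ⁺¹`: a matrix
sends `x ∈ Iⁿ` to the one of the vectors `g x`, `-g x` that lies on the sheet `Iⁿ`.  If `g`
preserves the sheet, this is `g x`. -/
noncomputable instance hyperboloidAction (n : ℕ) : MulAction (lorentzO n) (Hyperboloid n) where
  smul g x := ⟨toUpper (linAct g x.1), toUpper_mem (by rw [lorentzForm_linAct]; exact x.2.1)⟩
  one_smul x := by
    apply Subtype.ext
    change toUpper (linAct 1 x.1) = x.1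
    rw [linAct_one]
    exact if_pos x.2.2
  mul_smul g h x := by
    apply Subtype.ext
    change toUpper (linAct (g * h) x.1) = toUpper (linAct g (toUpper (linAct h x.1)))
    rw [toUpper_linAct_toUpper g (by rw [lorentzForm_linAct]; exact x.2.1), linAct_mul]

/-- `SO(n,1)`: the elements of `O(n,1)` of determinant `1`. -/
def lorentzSO (n : ℕ) : Subgroup (lorentzO n) where
  carrier := {g | ((g : GL (Fin (n + 1)) ℝ) : Matrix (Fin (n + 1)) (Fin (n + 1)) ℝ).det = 1}
  one_mem' := by simp
  mul_mem' := by
    intro a b ha hb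
    simp only [Set.mem_ofPred_eq] at ha hb
    simp [ha, hb]
  inv_mem' := by
    intro a ha
    simp only [Set.mem_ofPred_eq] at ha
    simp [ha]

/-- `O⁺(n,1)`: the elements of `O(n,1)` that preserve the sheet `Iⁿ`; this is the full isometry
group of hyperbolic `n`-space. -/
def lorentzOPlus (n : ℕ) : Subgroup (lorentzO n) where
  carrier := {g | ∀ x : Hyperboloid n, 0 < linAct g x.1 0}
  one_mem' := by
    intro x
    rw [linAct_one]
    exact x.2.2
  mul_mem' := by
    intro a b ha hb x
    rw [linAct_mul]
    exact ha ⟨linAct b x.1, by rw [lorentzForm_linAct]; exact x.2.1, hb x⟩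
  inv_mem' := by
    intro a ha x
    by_contra hneg
    have hq : lorentzForm (linAct a⁻¹ x.1) (linAct a⁻¹ x.1) = -1 := by
      rw [lorentzForm_linAct]; exact x.2.1
    have hlt := lt_of_le_of_ne (not_lt.mp hneg) (lorentz_time_ne_zero hq)
    have h := ha ⟨-linAct a⁻¹ x.1, by rw [lorentzForm_neg_neg, hq], by simpa using hlt⟩
    rw [linAct_neg, ← linAct_mul, mul_inv_cancel, linAct_one] at h
    have := x.2.2
    simp only [Pi.neg_apply] at h
    linarith

/-- `SO₀(n,1)`: the elements of `SO(n,1)` that preserve the sheet `Iⁿ` (the identity component). -/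
def lorentzSO0 (n : ℕ) : Subgroup (lorentzO n) := lorentzSO n ⊓ lorentzOPlus n

/-- The kernel `K(g, h) = d(g o, h o)` on a group `G` of Lorentz matrices. -/
noncomputable def orbitKernel {n : ℕ} (G : Subgroup (lorentzO n)) (o : Hyperboloid n) (g h : G) :
    ℝ :=
  hypDist (g • o) (h • o)

/-- Conditionally negative kernels on a set. -/
def IsCNK {V : Type*} (f : V → V → ℝ) : Prop :=
  ∀ (s : Finset V) (c : V → ℝ), ∑ v ∈ s, c v = 0 →
    ∑ v ∈ s, ∑ w ∈ s, c v * c w * f v w ≤ 0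

/-- Conditionally negative kernels on a group: left-invariant and conditionally negative on the
underlying set. -/
def IsGroupCNK {G : Type*} [Group G] (f : G → G → ℝ) : Prop :=
  IsCNK f ∧ ∀ g h k : G, f (g * h) (g * k) = f h k

/-- A kernel is bounded if its absolute value is bounded by a constant. -/
def IsBoundedKernel {V : Type*} (f : V → V → ℝ) : Prop :=
  ∃ C : ℝ, ∀ v w : V, |f v w| ≤ C

/-- Unit-speed bi-infinite geodesic lines in hyperbolic space. -/
def IsGeodesicLine {n : ℕ} (p : ℝ → Hyperboloid n) : Prop :=
  ∀ s t : ℝ, hypDist (p s) (p t) = |s - t|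

/-- `a` is the group of hyperbolic translations along the line `p`: `a t` moves every point of `p`
by `t` along `p`, and is the identity on the orthogonal complement of the plane spanned by `p`. -/
def IsTranslationAlong {n : ℕ} {G : Subgroup (lorentzO n)} (p : ℝ → Hyperboloid n)
    (a : Multiplicative ℝ →* G) : Prop :=
  (∀ t s : ℝ, a (Multiplicative.ofAdd t) • p s = p (s + t)) ∧
  ∀ (t : ℝ) (w : Fin (n + 1) → ℝ), (∀ s : ℝ, lorentzForm w (p s).1 = 0) →
    linAct (a (Multiplicative.ofAdd t) : lorentzO n) w = w

/-- Kazhdan's property (T) of a topological group `G`: there are a compact `Q ⊆ G` and `ε > 0` such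
that every (strongly continuous) unitary representation of `G` on a complex Hilbert space that has
a `(Q, ε)`-invariant vector has a nonzero invariant vector. -/
def HasPropertyT.{u} (G : Type u) [Group G] [TopologicalSpace G] : Prop :=
  ∃ Q : Set G, IsCompact Q ∧ ∃ ε : ℝ, 0 < ε ∧
    ∀ (H : Type u) [NormedAddCommGroup H] [InnerProductSpace ℂ H] [CompleteSpace H]
      (π : G →* unitary (H →L[ℂ] H)),
      (∀ ξ : H, Continuous fun g : G => (π g : H →L[ℂ] H) ξ) →
      (∃ ξ : H, ξ ≠ 0 ∧ ∀ q ∈ Q, ‖(π q : H →L[ℂ] H) ξ - ξ‖ < ε * ‖ξ‖) →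
      ∃ η : H, η ≠ 0 ∧ ∀ g : G, (π g : H →L[ℂ] H) η = η

/-! In the Klein ball model, `cosh d(x, y) = x₀ y₀ (1 - k(x, y))`, where `k` is a Gram kernel with
`|k| < 1`. Power series with nonnegative coefficients preserve positive semidefiniteness, so `-log
(1 - k)`, `(1 - k)⁻¹` and `(1 - k)^(-s)` are positive semidefinite, and rescaling by functions of
`x` and `y` separately gives the same for `(cosh d)^(-s)`, `s ≥ 0`.

For the distance itself, `d = log cosh d + log (1 + tanh d)` and `1 + tanh d = 2 (1 - r/2)` with `r
= 1 - tanh d = 1 - √(1 - (cosh d)⁻²)`. Since `1 - √(1 - q)` is a limit of polynomials in `q` with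
nonnegative coefficients, `r` is positive semidefinite, hence so is `-log (1 - r/2)`. Thus `d` is a
sum of one-variable functions minus a positive semidefinite kernel, which makes it conditionally
negative (`Hyperboloid.isCNK_hypDist`).

Unboundedness comes from explicit boosts along geodesics `cosh t • o + sinh t • v`. Property (T) is
refuted by the functions `φ_s(g) = (cosh d(o, g o))^(-s)`: they tend to `1` uniformly on compact
sets as `s → 0`, so their GNS vectors are almost invariant. For fixed `s > 0` they vanish along the
boosts, so translates of the cyclic vector tend weakly to `0` and no nonzero invariant vector exists
(`not_hasPropertyT_of_posSemidef`). -/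

namespace Matrix

/-! ### Positive semidefinite kernels and power series -/

variable {X : Type*}

theorem PosSemidef.sum_sum_nonneg {K : Matrix X X ℝ} (hK : K.PosSemidef) (s : Finset X)
    (c : X → ℝ) : 0 ≤ ∑ v ∈ s, ∑ w ∈ s, c v * c w * K v w := by
  classical
  have h := hK.2 (Finsupp.onFinset s (fun v => if v ∈ s then c v else 0) (by
    intro v hv
    by_contra hvs
    simp [hvs] at hv))
  rw [Finsupp.onFinset_sum _ (by simp)] at h
  refine h.trans_eq (Finset.sum_congr rfl fun v hv => ?_)
  rw [Finsupp.onFinset_sum _ (by simp)]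
  refine Finset.sum_congr rfl fun w hw => ?_
  simp only [hv, hw, if_true, star_trivial]
  ring

theorem PosSemidef.of_tendsto {ι : Type*} {l : Filter ι} [l.NeBot] {K : ι → Matrix X X ℝ}
    {L : Matrix X X ℝ} (hK : ∀ i, (K i).PosSemidef)
    (hL : ∀ x y, Tendsto (fun i => K i x y) l (𝓝 (L x y))) : L.PosSemidef := by
  refine ⟨?_, fun f => ?_⟩
  · ext x y
    refine tendsto_nhds_unique (hL y x) ((hL x y).congr fun i => ?_)
    simpa using ((hK i).1.apply x y).symm
  · refine ge_of_tendsto' (x := l) (tendsto_finsetSum _ fun v _ => tendsto_finsetSum _ fun w _ => ?_)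
      fun i => (hK i).2 f
    exact ((hL v w).const_mul _).mul_const _

theorem posSemidef_of_mul (f : X → ℝ) : (of fun x y => f x * f y).PosSemidef := by
  refine ⟨by ext x y; simp [mul_comm], fun c => ?_⟩
  have : (c.sum fun i xi => c.sum fun j xj => star xi * (of fun x y => f x * f y) i j * xj)
      = (c.sum fun i xi => xi * f i) ^ 2 := by
    simp only [Finsupp.sum, sq, Finset.sum_mul_sum, of_apply, star_trivial]
    exact Finset.sum_congr rfl fun _ _ => Finset.sum_congr rfl fun _ _ => by ring
  rw [this]
  positivity

theorem posSemidef_of_one : (of fun _ _ : X => (1 : ℝ)).PosSemidef := by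
  simpa using posSemidef_of_mul fun _ : X => (1 : ℝ)

theorem PosSemidef.of_mul {A B : Matrix X X ℝ} (hA : A.PosSemidef) (hB : B.PosSemidef) :
    (of fun x y => A x y * B x y).PosSemidef :=
  hA.hadamard hB

theorem PosSemidef.of_pow {K : Matrix X X ℝ} (hK : K.PosSemidef) (m : ℕ) :
    (of fun x y => K x y ^ m).PosSemidef := by
  induction m with
  | zero => simpa using posSemidef_of_one
  | succ m ih =>
    simp only [pow_succ]
    exact ih.of_mul hK

/-- If `f` is the sum of a power series with nonnegative coefficients on the values of a positive
semidefinite kernel `K`, then `f ∘ K` is positive semidefinite. -/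
theorem PosSemidef.of_hasSum_pow {K : Matrix X X ℝ} (hK : K.PosSemidef) {a : ℕ → ℝ}
    (ha : ∀ m, 0 ≤ a m) {L : Matrix X X ℝ}
    (hL : ∀ x y, HasSum (fun m => a m * K x y ^ m) (L x y)) : L.PosSemidef := by
  refine of_tendsto (l := atTop) (K := fun N => ∑ m ∈ Finset.range N, a m • of fun x y => K x y ^ m)
    (fun N => posSemidef_sum _ fun m _ => (hK.of_pow m).smul (ha m)) fun x y => ?_
  simpa [Matrix.sum_apply] using (hL x y).tendsto_sum_nat

theorem PosSemidef.of_exp {K : Matrix X X ℝ} (hK : K.PosSemidef) :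
    (of fun x y => Real.exp (K x y)).PosSemidef := by
  refine hK.of_hasSum_pow (a := fun m => (m.factorial : ℝ)⁻¹) (fun m => by positivity) fun x y => ?_
  have := NormedSpace.expSeries_div_hasSum_exp (K x y)
  rw [← Real.exp_eq_exp_ℝ] at this
  simpa [div_eq_inv_mul] using this

theorem PosSemidef.of_one_sub_inv {K : Matrix X X ℝ} (hK : K.PosSemidef)
    (h1 : ∀ x y, |K x y| < 1) : (of fun x y => (1 - K x y)⁻¹).PosSemidef :=
  hK.of_hasSum_pow (a := fun _ => 1) (fun _ => zero_le_one) fun x y => by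
    simpa using hasSum_geometric_of_abs_lt_one (h1 x y)

theorem PosSemidef.of_neg_log_one_sub {K : Matrix X X ℝ} (hK : K.PosSemidef)
    (h1 : ∀ x y, |K x y| < 1) : (of fun x y => -Real.log (1 - K x y)).PosSemidef := by
  refine hK.of_hasSum_pow (a := fun m => (m : ℝ)⁻¹) (fun m => by positivity) fun x y => ?_
  rw [← hasSum_nat_add_iff' 1]
  simpa [div_eq_inv_mul] using Real.hasSum_pow_div_log_of_abs_lt_one (h1 x y)

end Matrix

/-- The iteration `r ↦ (q + r²) / 2` started at `0`. -/
noncomputable def sqrtIter (q : ℝ) : ℕ → ℝ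
  | 0 => 0
  | m + 1 => (q + sqrtIter q m ^ 2) / 2

theorem sqrtIter_mem {q : ℝ} (h0 : 0 ≤ q) (h1 : q ≤ 1) (m : ℕ) :
    0 ≤ sqrtIter q m ∧ sqrtIter q m ≤ 1 ∧ sqrtIter q m ≤ sqrtIter q (m + 1) := by
  induction m with
  | zero => exact ⟨le_rfl, zero_le_one, by simp [sqrtIter]; positivity⟩
  | succ m ih =>
    obtain ⟨ha, hb, hc⟩ := ih
    have e : sqrtIter q (m + 1) = (q + sqrtIter q m ^ 2) / 2 := rfl
    have e' : sqrtIter q (m + 2) = (q + sqrtIter q (m + 1) ^ 2) / 2 := rfl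
    refine ⟨ha.trans hc, by rw [e]; nlinarith, ?_⟩
    rw [e', e]
    rw [e] at hc
    gcongr

/-- The iterates increase and stay below `1`. The limit solves `(1 - L)² = 1 - q`, and `L ≤ 1`
selects the root. -/
theorem tendsto_sqrtIter {q : ℝ} (h0 : 0 ≤ q) (h1 : q ≤ 1) :
    Tendsto (sqrtIter q) atTop (𝓝 (1 - √(1 - q))) := by
  have hmono : Monotone (sqrtIter q) := monotone_nat_of_le_succ fun m => (sqrtIter_mem h0 h1 m).2.2
  obtain ⟨L, hL⟩ : ∃ L, Tendsto (sqrtIter q) atTop (𝓝 L) := ⟨_, tendsto_atTop_ciSup hmono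
    ⟨1, by rintro _ ⟨m, rfl⟩; exact (sqrtIter_mem h0 h1 m).2.1⟩⟩
  have hL1 : L ≤ 1 := le_of_tendsto' hL fun m => (sqrtIter_mem h0 h1 m).2.1
  have hfix : L = (q + L ^ 2) / 2 :=
    tendsto_nhds_unique ((tendsto_add_atTop_iff_nat 1).2 hL) (((hL.pow 2).const_add q).div_const 2)
  have : √(1 - q) = 1 - L := by
    rw [show 1 - q = (1 - L) ^ 2 by linarith, Real.sqrt_sq (by linarith)]
  rwa [this, sub_sub_cancel]

/-- Each iterate is a polynomial in `q` with nonnegative coefficients, so the binomial series of the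
square root is not needed. -/
theorem Matrix.PosSemidef.of_one_sub_sqrt {X : Type*} {K : Matrix X X ℝ} (hK : K.PosSemidef)
    (h0 : ∀ x y, 0 ≤ K x y) (h1 : ∀ x y, K x y ≤ 1) :
    (Matrix.of fun x y => 1 - √(1 - K x y)).PosSemidef := by
  refine .of_tendsto (K := fun m => Matrix.of fun x y => sqrtIter (K x y) m) (fun m => ?_)
    fun x y => tendsto_sqrtIter (h0 x y) (h1 x y)
  induction m with
  | zero => exact Matrix.PosSemidef.zero
  | succ m ih =>
    convert (hK.add (ih.of_pow 2)).smul (show (0 : ℝ) ≤ 1 / 2 by norm_num) using 1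
    ext x y
    simp [sqrtIter]
    ring

/-- Coefficients of total sum zero annihilate the one-variable terms `a v` and `a w`. -/
theorem isCNK_of_posSemidef {V : Type*} {f : V → V → ℝ} {K : Matrix V V ℝ} (hK : K.PosSemidef)
    (a : V → ℝ) (h : ∀ v w, f v w = a v + a w - K v w) : IsCNK f := by
  intro s c hc
  have h1 : ∑ v ∈ s, ∑ w ∈ s, c v * c w * f v w
      = (∑ v ∈ s, c v * a v) * ∑ w ∈ s, c w + (∑ v ∈ s, c v) * (∑ w ∈ s, c w * a w)
        - ∑ v ∈ s, ∑ w ∈ s, c v * c w * K v w := by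
    simp only [Finset.sum_mul_sum, ← Finset.sum_add_distrib, ← Finset.sum_sub_distrib, h]
    exact Finset.sum_congr rfl fun _ _ => Finset.sum_congr rfl fun _ _ => by ring
  rw [h1, hc, mul_zero, zero_mul]
  linarith [hK.sum_sum_nonneg s c]

/-! ### The hyperbolic distance as a conditionally negative kernel -/

section Hyperbolic

variable {n : ℕ}

theorem lorentzForm_comm (x y : Fin (n + 1) → ℝ) : lorentzForm x y = lorentzForm y x := by
  simp [lorentzForm, mul_comm]

theorem lorentzForm_add_left (x y z : Fin (n + 1) → ℝ) :
    lorentzForm (x + y) z = lorentzForm x z + lorentzForm y z := by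
  simp only [lorentzForm, Pi.add_apply, add_mul, Finset.sum_add_distrib]
  ring

theorem lorentzForm_smul_left (c : ℝ) (x y : Fin (n + 1) → ℝ) :
    lorentzForm (c • x) y = c * lorentzForm x y := by
  simp only [lorentzForm, Pi.smul_apply, smul_eq_mul, mul_add, Finset.mul_sum, mul_assoc, mul_neg]

theorem lorentzForm_add_right (x y z : Fin (n + 1) → ℝ) :
    lorentzForm x (y + z) = lorentzForm x y + lorentzForm x z := by
  simp only [lorentzForm_comm x, lorentzForm_add_left]

theorem lorentzForm_smul_right (c : ℝ) (x y : Fin (n + 1) → ℝ) :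
    lorentzForm x (c • y) = c * lorentzForm x y := by
  simp only [lorentzForm_comm x, lorentzForm_smul_left]

theorem lorentzForm_neg_left (x y : Fin (n + 1) → ℝ) :
    lorentzForm (-x) y = -lorentzForm x y := by
  simpa using lorentzForm_smul_left (-1) x y

theorem continuous_lorentzForm_left (y : Fin (n + 1) → ℝ) :
    Continuous fun x : Fin (n + 1) → ℝ => lorentzForm x y := by
  unfold lorentzForm
  fun_prop

namespace Hyperboloid

/-- Minus the Lorentzian form, that is, the hyperbolic cosine of the distance. -/
def coshDist (x y : Hyperboloid n) : ℝ := -lorentzForm x.1 y.1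

/-- The inner product of the images of two points in the projective (Klein) ball model. -/
noncomputable def kleinInner (x y : Hyperboloid n) : ℝ :=
  ∑ i : Fin n, (x.1 i.succ / x.1 0) * (y.1 i.succ / y.1 0)

theorem time_pos (x : Hyperboloid n) : 0 < x.1 0 := x.2.2

theorem time_sq (x : Hyperboloid n) : x.1 0 ^ 2 = 1 + ∑ i : Fin n, x.1 i.succ ^ 2 := by
  have := x.2.1
  simp only [lorentzForm, ← sq] at this
  linarith

theorem coshDist_comm (x y : Hyperboloid n) : coshDist x y = coshDist y x := by
  rw [coshDist, lorentzForm_comm, coshDist]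

theorem coshDist_self (x : Hyperboloid n) : coshDist x x = 1 := by
  rw [coshDist, x.2.1, neg_neg]

theorem abs_sum_mul_le (x y : Hyperboloid n) :
    |∑ i : Fin n, x.1 i.succ * y.1 i.succ| ≤
      √(∑ i : Fin n, x.1 i.succ ^ 2) * √(∑ i : Fin n, y.1 i.succ ^ 2) := by
  rw [← Real.sqrt_mul (Finset.sum_nonneg fun i _ => sq_nonneg _), ← Real.sqrt_sq_eq_abs]
  exact Real.sqrt_le_sqrt (Finset.sum_mul_sq_le_sq_mul_sq _ _ _)

theorem sqrt_sum_sq_lt (x : Hyperboloid n) : √(∑ i : Fin n, x.1 i.succ ^ 2) < x.1 0 := by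
  rw [Real.sqrt_lt' x.time_pos, x.time_sq]
  linarith

/-- All positivity statements below rest on this factorization: the time coordinates only rescale
the kernel, and `kleinInner` is a Gram kernel of points in the open unit ball. -/
theorem coshDist_eq (x y : Hyperboloid n) :
    coshDist x y = x.1 0 * y.1 0 * (1 - kleinInner x y) := by
  have hx := x.time_pos.ne'
  have hy := y.time_pos.ne'
  have : x.1 0 * y.1 0 * kleinInner x y = ∑ i : Fin n, x.1 i.succ * y.1 i.succ := by
    rw [kleinInner, Finset.mul_sum]
    refine Finset.sum_congr rfl fun i _ => ?_
    field_simp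
  rw [mul_sub, this, coshDist, lorentzForm]
  ring

theorem abs_kleinInner_lt_one (x y : Hyperboloid n) : |kleinInner x y| < 1 := by
  have hx := x.time_pos
  have hy := y.time_pos
  have : kleinInner x y = (∑ i : Fin n, x.1 i.succ * y.1 i.succ) / (x.1 0 * y.1 0) := by
    rw [kleinInner, Finset.sum_div]
    exact Finset.sum_congr rfl fun i _ => div_mul_div_comm _ _ _ _
  rw [this, abs_div, abs_of_pos (mul_pos hx hy), div_lt_one (mul_pos hx hy)]
  exact (abs_sum_mul_le x y).trans_lt (mul_lt_mul'' x.sqrt_sum_sq_lt y.sqrt_sum_sq_lt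
    (Real.sqrt_nonneg _) (Real.sqrt_nonneg _))

theorem coshDist_pos (x y : Hyperboloid n) : 0 < coshDist x y := by
  rw [coshDist_eq]
  have := (abs_lt.1 (abs_kleinInner_lt_one x y)).2
  exact mul_pos (mul_pos x.time_pos y.time_pos) (by linarith)

theorem one_le_coshDist (x y : Hyperboloid n) : 1 ≤ coshDist x y := by
  have h1 : (∑ i : Fin n, x.1 i.succ * y.1 i.succ) ^ 2
      ≤ (x.1 0 ^ 2 - 1) * (y.1 0 ^ 2 - 1) := by
    rw [x.time_sq, y.time_sq, add_sub_cancel_left, add_sub_cancel_left]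
    exact Finset.sum_mul_sq_le_sq_mul_sq _ _ _
  have hx := x.time_pos
  have hy := y.time_pos
  have h2 : 1 ≤ x.1 0 * y.1 0 := by
    have a : 1 ≤ x.1 0 := by
      have := x.time_sq
      have : 0 ≤ ∑ i : Fin n, x.1 i.succ ^ 2 := Finset.sum_nonneg fun i _ => sq_nonneg _
      nlinarith
    have b : 1 ≤ y.1 0 := by
      have := y.time_sq
      have : 0 ≤ ∑ i : Fin n, y.1 i.succ ^ 2 := Finset.sum_nonneg fun i _ => sq_nonneg _
      nlinarith
    nlinarith
  have h3 : ∑ i : Fin n, x.1 i.succ * y.1 i.succ ≤ x.1 0 * y.1 0 - 1 := by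
    -- The squares compare because `(ab - 1)² - (a² - 1)(b² - 1) = (a - b)²`.
    refine le_of_sq_le_sq ?_ (by linarith)
    nlinarith [sq_nonneg (x.1 0 - y.1 0)]
  rw [coshDist, lorentzForm]
  linarith

theorem cosh_hypDist (x y : Hyperboloid n) : Real.cosh (hypDist x y) = coshDist x y :=
  Real.cosh_arcosh (one_le_coshDist x y)

/-- The sign chosen by `toUpper` is the one making the value positive, so the absolute value absorbs
it. -/
theorem coshDist_smul_left (g : lorentzO n) (x y : Hyperboloid n) :
    coshDist (g • x) y = |lorentzForm (linAct g x.1) y.1| := by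
  have h : (g • x).1 = linAct g x.1 ∨ (g • x).1 = -linAct g x.1 := by
    change toUpper _ = _ ∨ toUpper _ = _
    unfold toUpper
    split_ifs <;> simp
  have hpos := coshDist_pos (g • x) y
  rw [coshDist] at hpos ⊢
  rcases h with h | h
  · rw [h] at hpos ⊢
    rw [abs_of_neg (by linarith)]
  · rw [h, lorentzForm_neg_left, neg_neg] at hpos ⊢
    rw [abs_of_pos hpos]

theorem coshDist_smul_smul (g : lorentzO n) (x y : Hyperboloid n) :
    coshDist (g • x) (g • y) = coshDist x y := by
  rw [coshDist_smul_left, lorentzForm_comm]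
  change |lorentzForm (toUpper (linAct g y.1)) (linAct g x.1)| = _
  have h : |lorentzForm (toUpper (linAct g y.1)) (linAct g x.1)| =
      |lorentzForm (linAct g y.1) (linAct g x.1)| := by
    unfold toUpper
    split_ifs
    · rfl
    · rw [lorentzForm_neg_left, abs_neg]
  rw [h, lorentzForm_linAct, lorentzForm_comm, ← abs_neg]
  exact abs_of_pos (coshDist_pos x y)

theorem hypDist_smul_smul (g : lorentzO n) (x y : Hyperboloid n) :
    hypDist (g • x) (g • y) = hypDist x y :=
  congrArg Real.arcosh (coshDist_smul_smul g x y)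

theorem posSemidef_kleinInner :
    (Matrix.of fun x y : Hyperboloid n => kleinInner x y).PosSemidef := by
  have := Matrix.posSemidef_sum Finset.univ fun (i : Fin n) _ =>
    Matrix.posSemidef_of_mul fun x : Hyperboloid n => x.1 i.succ / x.1 0
  convert this using 1
  ext x y
  simp [kleinInner, Matrix.sum_apply]

theorem posSemidef_coshDist_inv :
    (Matrix.of fun x y : Hyperboloid n => (coshDist x y)⁻¹).PosSemidef := by
  have h := (Matrix.posSemidef_of_mul fun x : Hyperboloid n => (x.1 0)⁻¹).of_mul
    (posSemidef_kleinInner.of_one_sub_inv abs_kleinInner_lt_one)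
  convert h using 1
  ext x y
  simp [coshDist_eq, mul_comm]

/-- Here `(1 - k)^(-s) = exp (s * -log (1 - k))`, and both the series of `-log (1 - k)` and that of
`exp` have nonnegative coefficients. -/
theorem posSemidef_coshDist_rpow {s : ℝ} (hs : 0 ≤ s) :
    (Matrix.of fun x y : Hyperboloid n => coshDist x y ^ (-s)).PosSemidef := by
  have h := (Matrix.posSemidef_of_mul fun x : Hyperboloid n => x.1 0 ^ (-s)).of_mul
    ((posSemidef_kleinInner.of_neg_log_one_sub abs_kleinInner_lt_one).smul hs).of_exp
  convert h using 1
  ext x y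
  have := (abs_lt.1 (abs_kleinInner_lt_one x y)).2
  have hx := x.time_pos
  have hy := y.time_pos
  simp only [Matrix.of_apply, Matrix.smul_apply, smul_eq_mul]
  rw [coshDist_eq, Real.mul_rpow (by positivity) (by linarith), Real.mul_rpow hx.le hy.le,
    Real.rpow_def_of_pos (by linarith : 0 < 1 - kleinInner x y)]
  congr 2
  ring

/-- The positive semidefinite kernel `1 - tanh d(x, y)`. -/
theorem posSemidef_one_sub_sqrt :
    (Matrix.of fun x y : Hyperboloid n => 1 - √(1 - (coshDist x y)⁻¹ ^ 2)).PosSemidef :=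
  (posSemidef_coshDist_inv.of_pow 2).of_one_sub_sqrt (fun _ _ => sq_nonneg _) fun x y =>
    pow_le_one₀ (inv_nonneg.2 (coshDist_pos x y).le) (inv_le_one_of_one_le₀ (one_le_coshDist x y))

/-- With `u = cosh d`, this is `exp d = cosh d + sinh d = cosh d * (1 + tanh d)`. -/
theorem arcosh_eq_log_add_log {u : ℝ} (hu : 1 ≤ u) :
    Real.arcosh u = Real.log u + Real.log (1 + √(1 - u⁻¹ ^ 2)) := by
  have h0 : 0 < u := by linarith
  rw [← Real.log_mul h0.ne' (by positivity), Real.arcosh, mul_add, mul_one]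
  congr 2
  rw [show u ^ 2 - 1 = u ^ 2 * (1 - u⁻¹ ^ 2) by field_simp, Real.sqrt_mul (sq_nonneg _),
    Real.sqrt_sq h0.le]

/-- The hyperbolic distance is a conditionally negative kernel. -/
theorem isCNK_hypDist : IsCNK (hypDist : Hyperboloid n → Hyperboloid n → ℝ) := by
  have hr : ∀ x y : Hyperboloid n, |1 / 2 * (1 - √(1 - (coshDist x y)⁻¹ ^ 2))| < 1 := by
    intro x y
    have h0 := Real.sqrt_nonneg (1 - (coshDist x y)⁻¹ ^ 2)
    have h1 : √(1 - (coshDist x y)⁻¹ ^ 2) ≤ 1 := Real.sqrt_le_one.2 (by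
      linarith [sq_nonneg (coshDist x y)⁻¹])
    rw [abs_lt]
    constructor <;> linarith
  -- The kernel `-log (1 - k) - log (1 - r/2)` with `r = 1 - tanh d`; the remaining `log 2` is
  -- shared equally between the two points.
  have hK := (posSemidef_kleinInner (n := n).of_neg_log_one_sub abs_kleinInner_lt_one).add
    ((posSemidef_one_sub_sqrt.smul (show (0 : ℝ) ≤ 1 / 2 by norm_num)).of_neg_log_one_sub hr)
  refine isCNK_of_posSemidef hK (fun x => Real.log (x.1 0) + Real.log 2 / 2) fun x y => ?_
  have hz := (abs_lt.1 (abs_kleinInner_lt_one x y)).2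
  have hr' := (abs_lt.1 (hr x y)).2
  have hx := x.time_pos
  have hy := y.time_pos
  change Real.arcosh (coshDist x y) = _
  rw [arcosh_eq_log_add_log (one_le_coshDist x y)]
  have h2 : 1 + √(1 - (coshDist x y)⁻¹ ^ 2)
      = 2 * (1 - 1 / 2 * (1 - √(1 - (coshDist x y)⁻¹ ^ 2))) := by ring
  rw [h2, Real.log_mul two_ne_zero (by linarith)]
  nth_rewrite 1 [coshDist_eq]
  rw [Real.log_mul (by positivity) (by linarith), Real.log_mul hx.ne' hy.ne']
  simp only [Matrix.add_apply, Matrix.of_apply, Matrix.smul_apply, smul_eq_mul]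
  ring

end Hyperboloid

/-- The map need not be injective (an orbit map has stabilizers), so coefficients are summed over
its fibres. -/
theorem IsCNK.comp {V W : Type*} {f : W → W → ℝ} (hf : IsCNK f) (φ : V → W) :
    IsCNK fun v w => f (φ v) (φ w) := by
  classical
  intro s c hc
  have key := hf (s.image φ) (fun w => ∑ v ∈ s with φ v = w, c v)
    (by rwa [Finset.sum_fiberwise_of_maps_to fun v hv => Finset.mem_image_of_mem φ hv])
  refine le_of_eq_of_le ?_ key
  have hmem := fun v (hv : v ∈ s) => Finset.mem_image_of_mem φ hv
  rw [← Finset.sum_fiberwise_of_maps_to hmem]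
  refine Finset.sum_congr rfl fun a _ => ?_
  rw [Finset.sum_congr rfl fun v (_ : v ∈ s.filter (φ · = a)) =>
    (Finset.sum_fiberwise_of_maps_to hmem fun w => c v * c w * f (φ v) (φ w)).symm,
    Finset.sum_comm]
  refine Finset.sum_congr rfl fun b _ => ?_
  rw [Finset.sum_mul_sum, Finset.sum_mul]
  refine Finset.sum_congr rfl fun v hv => ?_
  rw [Finset.sum_mul]
  refine Finset.sum_congr rfl fun w hw => ?_
  rw [(Finset.mem_filter.1 hv).2, (Finset.mem_filter.1 hw).2]

end Hyperbolic

/-! ### Geodesic lines -/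

section Geodesics

variable {n : ℕ}

theorem lorentzForm_sub_left (x y z : Fin (n + 1) → ℝ) :
    lorentzForm (x - y) z = lorentzForm x z - lorentzForm y z := by
  rw [sub_eq_add_neg, lorentzForm_add_left, lorentzForm_neg_left, sub_eq_add_neg]

/-- A vector orthogonal to a point of the hyperboloid is spacelike or zero. -/
theorem eq_zero_of_lorentzForm_self_eq_zero (o : Hyperboloid n) {w : Fin (n + 1) → ℝ}
    (h1 : lorentzForm w o.1 = 0) (h2 : lorentzForm w w = 0) : w = 0 := by
  have ho := o.time_pos
  have hs := o.time_sq
  have hS : 0 ≤ ∑ i : Fin n, o.1 i.succ ^ 2 := Finset.sum_nonneg fun i _ => sq_nonneg _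
  simp only [lorentzForm, ← sq] at h1 h2
  -- Cauchy–Schwarz on the spatial parts becomes `w₀² o₀² ≤ w₀² (o₀² - 1)`, forcing `w₀ = 0`.
  have hcs := Finset.sum_mul_sq_le_sq_mul_sq Finset.univ (fun i : Fin n => w i.succ)
    fun i => o.1 i.succ
  rw [show ∑ i : Fin n, w i.succ * o.1 i.succ = w 0 * o.1 0 by linarith,
    show ∑ i : Fin n, w i.succ ^ 2 = w 0 ^ 2 by linarith] at hcs
  have h0 : w 0 = 0 := by
    have : w 0 ^ 2 ≤ 0 := by nlinarith
    nlinarith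
  have hz : ∑ i : Fin n, w i.succ ^ 2 = 0 := by rw [h0] at h2; linarith
  rw [Finset.sum_eq_zero_iff_of_nonneg fun i _ => sq_nonneg _] at hz
  funext i
  refine Fin.cases h0 (fun j => ?_) i
  simpa using hz j (Finset.mem_univ j)

/-- The vector `cosh t · o + sinh t · v`. -/
noncomputable def geodesicVec (o v : Fin (n + 1) → ℝ) (t : ℝ) : Fin (n + 1) → ℝ :=
  Real.cosh t • o + Real.sinh t • v

/-- `v` is a unit tangent vector of the hyperboloid at `o`. -/
structure IsUnitTangent (o : Hyperboloid n) (v : Fin (n + 1) → ℝ) : Prop where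
  orth : lorentzForm v o.1 = 0
  unit : lorentzForm v v = 1

namespace IsUnitTangent

variable {o : Hyperboloid n} {v : Fin (n + 1) → ℝ}

theorem orth' (hv : IsUnitTangent o v) : lorentzForm o.1 v = 0 := by
  rw [lorentzForm_comm, hv.orth]

theorem lorentzForm_geodesicVec (hv : IsUnitTangent o v) (s t : ℝ) :
    lorentzForm (geodesicVec o.1 v s) (geodesicVec o.1 v t) = -Real.cosh (s - t) := by
  simp only [geodesicVec, lorentzForm_add_left, lorentzForm_add_right, lorentzForm_smul_left,
    lorentzForm_smul_right, hv.orth, hv.orth', hv.unit, o.2.1, Real.cosh_sub]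
  ring

theorem geodesicVec_self (hv : IsUnitTangent o v) (t : ℝ) :
    lorentzForm (geodesicVec o.1 v t) (geodesicVec o.1 v t) = -1 := by
  rw [hv.lorentzForm_geodesicVec, sub_self, Real.cosh_zero]

theorem time_sq_lt (hv : IsUnitTangent o v) : v 0 ^ 2 < o.1 0 ^ 2 := by
  have ho := o.time_pos
  have hs := o.time_sq
  have h1 := hv.orth
  have h2 := hv.unit
  simp only [lorentzForm, ← sq] at h1 h2
  have hcs := Finset.sum_mul_sq_le_sq_mul_sq Finset.univ (fun i : Fin n => v i.succ)
    fun i => o.1 i.succ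
  rw [show ∑ i : Fin n, v i.succ * o.1 i.succ = v 0 * o.1 0 by linarith,
    show ∑ i : Fin n, v i.succ ^ 2 = 1 + v 0 ^ 2 by linarith] at hcs
  nlinarith

theorem geodesicVec_time_pos (hv : IsUnitTangent o v) (t : ℝ) : 0 < geodesicVec o.1 v t 0 := by
  have h1 : |v 0| < o.1 0 := by
    simpa [abs_of_pos o.time_pos] using sq_lt_sq.1 hv.time_sq_lt
  have h2 : |Real.sinh t| < Real.cosh t := by
    rw [← abs_of_pos (Real.cosh_pos t), ← sq_lt_sq, Real.cosh_sq]
    linarith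
  have h3 : |Real.sinh t * v 0| < Real.cosh t * o.1 0 := by
    rw [abs_mul]
    exact mul_lt_mul'' h2 h1 (abs_nonneg _) (abs_nonneg _)
  have := (abs_lt.1 h3).1
  simp only [geodesicVec, Pi.add_apply, Pi.smul_apply, smul_eq_mul]
  linarith

/-- The geodesic line through `o` with direction `v`. -/
noncomputable def geodesic (hv : IsUnitTangent o v) (t : ℝ) : Hyperboloid n :=
  ⟨geodesicVec o.1 v t, hv.geodesicVec_self t, hv.geodesicVec_time_pos t⟩

theorem isGeodesicLine_geodesic (hv : IsUnitTangent o v) : IsGeodesicLine hv.geodesic := by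
  intro s t
  change Real.arcosh (-lorentzForm (geodesicVec o.1 v s) (geodesicVec o.1 v t)) = _
  rw [hv.lorentzForm_geodesicVec, neg_neg, ← Real.cosh_abs, Real.arcosh_cosh (abs_nonneg _)]

theorem geodesic_zero (hv : IsUnitTangent o v) : hv.geodesic 0 = o :=
  Subtype.ext (by simp [geodesic, geodesicVec])

end IsUnitTangent

theorem exists_isUnitTangent (hn : 1 ≤ n) (o : Hyperboloid n) : ∃ v, IsUnitTangent o v := by
  obtain ⟨m, rfl⟩ : ∃ m, n = m + 1 := ⟨n - 1, by omega⟩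
  let e : Fin (m + 1 + 1) → ℝ := Fin.cons 0 (Pi.single 0 1)
  have hee : lorentzForm e e = 1 := by
    simp [lorentzForm, e, Pi.single_apply]
  -- Projection of a spacelike basis vector to the complement of `o`; the sign is `+` because `⟨o,
  -- o⟩ = -1`.
  let w := e + lorentzForm e o.1 • o.1
  have hwo : lorentzForm w o.1 = 0 := by
    simp only [w, lorentzForm_add_left, lorentzForm_smul_left, o.2.1]
    ring
  have hww : lorentzForm w w = 1 + lorentzForm e o.1 ^ 2 := by
    simp only [w, lorentzForm_add_left, lorentzForm_smul_left, lorentzForm_add_right,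
      lorentzForm_smul_right, o.2.1, hee, lorentzForm_comm o.1 e]
    ring
  have hpos : 0 < lorentzForm w w := by rw [hww]; positivity
  refine ⟨(√(lorentzForm w w))⁻¹ • w, ?_, ?_⟩
  · rw [lorentzForm_smul_left, hwo, mul_zero]
  · rw [lorentzForm_smul_left, lorentzForm_smul_right, ← mul_assoc, ← mul_inv,
      Real.mul_self_sqrt hpos.le, inv_mul_cancel₀ hpos.ne']

theorem IsGeodesicLine.lorentzForm_eq {p : ℝ → Hyperboloid n} (hp : IsGeodesicLine p) (s t : ℝ) :
    lorentzForm (p s).1 (p t).1 = -Real.cosh (s - t) := by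
  have := Hyperboloid.cosh_hypDist (p s) (p t)
  rw [hp, Real.cosh_abs, Hyperboloid.coshDist] at this
  linarith

/-- Every geodesic line in the hyperboloid model is `t ↦ cosh t · o + sinh t · v`. -/
theorem IsGeodesicLine.exists_eq_geodesicVec {p : ℝ → Hyperboloid n} (hp : IsGeodesicLine p) :
    ∃ v, IsUnitTangent (p 0) v ∧ ∀ t, (p t).1 = geodesicVec (p 0).1 v t := by
  have hs : Real.sinh 1 ≠ 0 := (Real.sinh_pos_iff.2 one_pos).ne'
  have h00 : lorentzForm (p 0).1 (p 0).1 = -1 := (p 0).2.1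
  have h11 : lorentzForm (p 1).1 (p 1).1 = -1 := (p 1).2.1
  have h10 : lorentzForm (p 1).1 (p 0).1 = -Real.cosh 1 := by rw [hp.lorentzForm_eq, sub_zero]
  have h01 := (lorentzForm_comm (p 0).1 (p 1).1).trans h10
  have hcs := Real.cosh_sq 1
  -- Solved from `p 1 = cosh 1 • p 0 + sinh 1 • v`.
  let v : Fin (n + 1) → ℝ :=
    (Real.sinh 1)⁻¹ • (p 1).1 + (-((Real.sinh 1)⁻¹ * Real.cosh 1)) • (p 0).1
  have hv : IsUnitTangent (p 0) v := by
    constructor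
    · simp only [v, lorentzForm_add_left, lorentzForm_smul_left, h10, h00]
      ring
    · simp only [v, lorentzForm_add_left, lorentzForm_smul_left, lorentzForm_add_right,
        lorentzForm_smul_right, h10, h00, h01, h11]
      field_simp
      linarith
  refine ⟨v, hv, fun t => ?_⟩
  have ht0 : lorentzForm (p t).1 (p 0).1 = -Real.cosh t := by rw [hp.lorentzForm_eq, sub_zero]
  have htv : lorentzForm (p t).1 v = Real.sinh t := by
    simp only [v, lorentzForm_add_right, lorentzForm_smul_right, ht0, hp.lorentzForm_eq t 1,
      Real.cosh_sub]
    field_simp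
    ring
  have h0t := (lorentzForm_comm (p 0).1 (p t).1).trans ht0
  have hvt := (lorentzForm_comm v (p t).1).trans htv
  -- The difference of the two points is orthogonal to `p 0` and null, hence zero.
  rw [← sub_eq_zero]
  refine eq_zero_of_lorentzForm_self_eq_zero (p 0) ?_ ?_
  · simp only [geodesicVec, lorentzForm_sub_left, lorentzForm_add_left, lorentzForm_smul_left, ht0,
      h00, hv.orth]
    ring
  · rw [lorentzForm_sub_left, lorentzForm_comm (p t).1, lorentzForm_comm (geodesicVec _ _ _),
      lorentzForm_sub_left, lorentzForm_sub_left, hv.geodesicVec_self]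
    simp only [geodesicVec, lorentzForm_add_left, lorentzForm_add_right, lorentzForm_smul_left,
      lorentzForm_smul_right, h0t, hvt, ht0, htv, (p t).2.1]
    linarith [Real.cosh_sq t]

end Geodesics

/-! ### Hyperbolic translations -/

section Boost

variable {n : ℕ}

/-- The linear functional `x ↦ ⟨x, y⟩`. -/
def lorentzLeft (y : Fin (n + 1) → ℝ) : (Fin (n + 1) → ℝ) →ₗ[ℝ] ℝ where
  toFun x := lorentzForm x y
  map_add' x x' := lorentzForm_add_left x x' y
  map_smul' c x := lorentzForm_smul_left c x y

/-- The hyperbolic translation by `t` in the plane spanned by `o` and `v`. -/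
noncomputable def boost (o v : Fin (n + 1) → ℝ) (t : ℝ) :
    (Fin (n + 1) → ℝ) →ₗ[ℝ] (Fin (n + 1) → ℝ) :=
  LinearMap.id +
    ((1 - Real.cosh t) • lorentzLeft o + Real.sinh t • lorentzLeft v).smulRight o +
    ((-Real.sinh t) • lorentzLeft o + (Real.cosh t - 1) • lorentzLeft v).smulRight v

theorem boost_apply (o v x : Fin (n + 1) → ℝ) (t : ℝ) :
    boost o v t x = x +
      ((1 - Real.cosh t) * lorentzForm x o + Real.sinh t * lorentzForm x v) • o +
      (-Real.sinh t * lorentzForm x o + (Real.cosh t - 1) * lorentzForm x v) • v := by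
  simp [boost, lorentzLeft]

theorem boost_zero (o v : Fin (n + 1) → ℝ) : boost o v 0 = LinearMap.id :=
  LinearMap.ext fun x => by simp [boost_apply]

namespace IsUnitTangent

variable {o : Hyperboloid n} {v : Fin (n + 1) → ℝ}

theorem boost_comp_boost (hv : IsUnitTangent o v) (s t : ℝ) :
    boost o.1 v s ∘ₗ boost o.1 v t = boost o.1 v (s + t) := by
  refine LinearMap.ext fun x => ?_
  simp only [LinearMap.comp_apply, boost_apply, lorentzForm_add_left, lorentzForm_smul_left,
    hv.orth, hv.orth', hv.unit, o.2.1, Real.cosh_add, Real.sinh_add]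
  module

theorem lorentzForm_boost (hv : IsUnitTangent o v) (t : ℝ) (x y : Fin (n + 1) → ℝ) :
    lorentzForm (boost o.1 v t x) (boost o.1 v t y) = lorentzForm x y := by
  simp only [boost_apply, lorentzForm_add_left, lorentzForm_smul_left, lorentzForm_add_right,
    lorentzForm_smul_right, hv.orth, hv.orth', hv.unit, o.2.1, lorentzForm_comm o.1 y,
    lorentzForm_comm v y]
  linear_combination ((lorentzForm x o.1) * (lorentzForm y o.1)
    - lorentzForm x v * lorentzForm y v) * -Real.cosh_sq t

theorem boost_geodesicVec (hv : IsUnitTangent o v) (s t : ℝ) :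
    boost o.1 v t (geodesicVec o.1 v s) = geodesicVec o.1 v (s + t) := by
  simp only [geodesicVec, boost_apply, lorentzForm_add_left, lorentzForm_smul_left,
    hv.orth, hv.orth', hv.unit, o.2.1, Real.cosh_add, Real.sinh_add]
  module

/-- The reflection `R` in the complement of `v` conjugates the boost by `t` to the boost by `-t`, so
these have equal determinants, with product `1`. Halving `t` then removes the sign ambiguity. -/
theorem det_boost (hv : IsUnitTangent o v) (t : ℝ) : LinearMap.det (boost o.1 v t) = 1 := by
  let R : (Fin (n + 1) → ℝ) →ₗ[ℝ] (Fin (n + 1) → ℝ) :=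
    LinearMap.id + ((-2 : ℝ) • lorentzLeft v).smulRight v
  have hR : ∀ x, R x = x + (-2 * lorentzForm x v) • v := fun x => by simp [R, lorentzLeft]
  have hRR : R ∘ₗ R = LinearMap.id := by
    refine LinearMap.ext fun x => ?_
    simp only [LinearMap.comp_apply, hR, lorentzForm_add_left, lorentzForm_smul_left, hv.unit,
      LinearMap.id_apply]
    module
  have hRB : ∀ t, R ∘ₗ boost o.1 v t = boost o.1 v (-t) ∘ₗ R := fun t => by
    refine LinearMap.ext fun x => ?_
    simp only [LinearMap.comp_apply, hR, boost_apply, lorentzForm_add_left, lorentzForm_smul_left,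
      hv.orth, hv.orth', hv.unit, Real.cosh_neg, Real.sinh_neg]
    module
  have hR0 : LinearMap.det R ≠ 0 := by
    have := congrArg LinearMap.det hRR
    rw [LinearMap.det_comp, LinearMap.det_id] at this
    exact left_ne_zero_of_mul_eq_one this
  have hsymm : ∀ t, LinearMap.det (boost o.1 v t) = LinearMap.det (boost o.1 v (-t)) := fun t => by
    have := congrArg LinearMap.det (hRB t)
    rw [LinearMap.det_comp, LinearMap.det_comp, mul_comm] at this
    exact mul_right_cancel₀ hR0 this
  have hadd : ∀ s t, LinearMap.det (boost o.1 v (s + t)) =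
      LinearMap.det (boost o.1 v s) * LinearMap.det (boost o.1 v t) := fun s t => by
    rw [← hv.boost_comp_boost, LinearMap.det_comp]
  have h := hadd (t / 2) (-(t / 2))
  rw [← hsymm, add_neg_cancel, boost_zero, LinearMap.det_id] at h
  rw [← add_halves t, hadd, ← h]

/-- The boost as an element of `O(n,1)`. -/
noncomputable def boostO (hv : IsUnitTangent o v) (t : ℝ) : lorentzO n :=
  ⟨⟨LinearMap.toMatrix' (boost o.1 v t), LinearMap.toMatrix' (boost o.1 v (-t)),
    by rw [← LinearMap.toMatrix'_comp, hv.boost_comp_boost, add_neg_cancel, boost_zero,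
      LinearMap.toMatrix'_id],
    by rw [← LinearMap.toMatrix'_comp, hv.boost_comp_boost, neg_add_cancel, boost_zero,
      LinearMap.toMatrix'_id]⟩,
  fun x y => by
    change lorentzForm (LinearMap.toMatrix' _ *ᵥ x) (LinearMap.toMatrix' _ *ᵥ y) = _
    rw [LinearMap.toMatrix'_mulVec, LinearMap.toMatrix'_mulVec, hv.lorentzForm_boost]⟩

theorem linAct_boostO (hv : IsUnitTangent o v) (t : ℝ) (x : Fin (n + 1) → ℝ) :
    linAct (hv.boostO t) x = boost o.1 v t x :=
  LinearMap.toMatrix'_mulVec _ _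

theorem boostO_mem (hv : IsUnitTangent o v) (t : ℝ) : hv.boostO t ∈ lorentzSO0 n := by
  refine ⟨?_, fun x => ?_⟩
  · change (LinearMap.toMatrix' _).det = 1
    rw [LinearMap.det_toMatrix', hv.det_boost]
  · have hx : lorentzForm (linAct (hv.boostO t) x.1) (linAct (hv.boostO t) x.1) = -1 := by
      rw [lorentzForm_linAct, x.2.1]
    -- Otherwise `-Bx` lies on the sheet, and so does `Bo`; their `coshDist` would be `⟨x, o⟩ ≤ -1`.
    by_contra hneg
    have hlt := lt_of_le_of_ne (not_lt.mp hneg) (lorentz_time_ne_zero hx)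
    have h1 := Hyperboloid.one_le_coshDist
      ⟨-linAct (hv.boostO t) x.1, by rw [lorentzForm_neg_neg, hx], by simpa using hlt⟩
      (hv.geodesic t)
    have h2 : linAct (hv.boostO t) o.1 = geodesicVec o.1 v t := by
      rw [linAct_boostO]
      simpa [geodesicVec] using hv.boost_geodesicVec 0 t
    have h3 := Hyperboloid.one_le_coshDist x o
    simp only [Hyperboloid.coshDist, geodesic, ← h2, lorentzForm_neg_left, lorentzForm_linAct]
      at h1 h3
    linarith

theorem boostO_smul_geodesic (hv : IsUnitTangent o v) (s t : ℝ) :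
    hv.boostO t • hv.geodesic s = hv.geodesic (s + t) := by
  apply Subtype.ext
  change toUpper (linAct (hv.boostO t) (geodesicVec o.1 v s)) = geodesicVec o.1 v (s + t)
  rw [linAct_boostO, hv.boost_geodesicVec]
  exact if_pos (hv.geodesicVec_time_pos _)

/-- The one-parameter group of boosts in a group containing `SO₀(n,1)`. -/
noncomputable def boostHom (hv : IsUnitTangent o v) {G : Subgroup (lorentzO n)}
    (hG : lorentzSO0 n ≤ G) : Multiplicative ℝ →* G where
  toFun t := ⟨hv.boostO t.toAdd, hG (hv.boostO_mem _)⟩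
  map_one' := by
    refine Subtype.ext (Subtype.ext (Units.ext ?_))
    change LinearMap.toMatrix' (boost o.1 v 0) = 1
    rw [boost_zero, LinearMap.toMatrix'_id]
  map_mul' s t := by
    refine Subtype.ext (Subtype.ext (Units.ext ?_))
    change LinearMap.toMatrix' (boost o.1 v (s.toAdd + t.toAdd)) =
      LinearMap.toMatrix' (boost o.1 v s.toAdd) * LinearMap.toMatrix' (boost o.1 v t.toAdd)
    rw [← LinearMap.toMatrix'_comp, hv.boost_comp_boost]

theorem continuous_boostHom (hv : IsUnitTangent o v) {G : Subgroup (lorentzO n)}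
    (hG : lorentzSO0 n ≤ G) : Continuous (hv.boostHom hG) := by
  have key : Continuous fun t : ℝ => LinearMap.toMatrix' (boost o.1 v t) := by
    refine continuous_matrix fun i j => ?_
    simp only [LinearMap.toMatrix'_apply, boost_apply, Pi.add_apply, Pi.smul_apply, smul_eq_mul]
    have := Real.continuous_cosh
    have := Real.continuous_sinh
    fun_prop
  refine Continuous.subtype_mk (Continuous.subtype_mk (Units.continuous_iff.2 ⟨?_, ?_⟩) _) _
  · exact key.comp continuous_toAdd
  · exact key.comp continuous_toAdd.neg

theorem boostHom_smul (hv : IsUnitTangent o v) {G : Subgroup (lorentzO n)}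
    (hG : lorentzSO0 n ≤ G) (t : ℝ) : hv.boostHom hG (.ofAdd t) • o = hv.geodesic t := by
  have := hv.boostO_smul_geodesic 0 t
  rwa [geodesic_zero, zero_add] at this

theorem isTranslationAlong_boostHom {p : ℝ → Hyperboloid n} (hv : IsUnitTangent o v)
    (hp : p = hv.geodesic) {G : Subgroup (lorentzO n)} (hG : lorentzSO0 n ≤ G) :
    IsTranslationAlong p (hv.boostHom hG) := by
  subst hp
  refine ⟨fun t s => hv.boostO_smul_geodesic s t, fun t w hw => ?_⟩
  have h0 : lorentzForm w o.1 = 0 := by simpa [hv.geodesic_zero] using hw 0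
  -- The points at times `0` and `1` already span the plane, since `sinh 1 ≠ 0`.
  have h1 := hw 1
  simp only [geodesic, geodesicVec, lorentzForm_add_right, lorentzForm_smul_right, h0, mul_zero,
    zero_add, mul_eq_zero, (Real.sinh_pos_iff.2 one_pos).ne', false_or] at h1
  change linAct (hv.boostO t) w = w
  rw [linAct_boostO, boost_apply, h0, h1]
  simp

end IsUnitTangent

end Boost

/-! ### Unitary representations from positive definite functions -/

section UnitaryRep

/-- Every real positive semidefinite kernel is the Gram matrix of a total family of vectors of a
complex Hilbert space. -/
theorem Matrix.PosSemidef.exists_gram.{u} {X : Type u} {K : Matrix X X ℝ} (hK : K.PosSemidef) :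
    ∃ (H : Type u) (_ : NormedAddCommGroup H) (_ : InnerProductSpace ℂ H) (_ : CompleteSpace H)
      (Φ : X → H), (∀ x y, inner ℂ (Φ x) (Φ y) = (K x y : ℂ)) ∧
        (Submodule.span ℂ (Set.range Φ)).topologicalClosure = ⊤ := by
  let K' : Matrix X X (ℂ →L[ℂ] ℂ) := Matrix.of fun x y => (K x y : ℂ) • ContinuousLinearMap.id ℂ ℂ
  have hK' : K'.PosSemidef := by
    refine ((RKHS.posSemidef_tfae (K := K')).out 0 2 rfl rfl).2 ⟨?_, fun c => ?_⟩
    · ext x y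
      have := hK.1.apply x y
      simp only [star_trivial] at this
      simp [K', this, ← ContinuousLinearMap.one_def]
    · have h1 := hK.sum_sum_nonneg c.support fun x => (c x).re
      have h2 := hK.sum_sum_nonneg c.support fun x => (c x).im
      refine (add_nonneg h1 h2).trans_eq ?_
      simp only [Finsupp.sum, map_sum, ← Finset.sum_add_distrib]
      refine Finset.sum_congr rfl fun x _ => Finset.sum_congr rfl fun y _ => ?_
      have := hK.1.apply x y
      simp only [star_trivial] at this
      simp [K', this]
      ring
  have : Fact K'.PosSemidef := ⟨hK'⟩
  have key : ∀ x y, RKHS.kernel (RKHS.OfKernel K') x y = K' x y := fun x y => by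
    rw [RKHS.OfKernel.kernel_ofKernel]
  refine ⟨RKHS.OfKernel K', inferInstance, inferInstance, inferInstance,
    fun x => RKHS.kerFun (RKHS.OfKernel K') x 1, fun x y => ?_, ?_⟩
  · rw [RKHS.kerFun_inner, RKHS.kerFun_apply, key]
    simp [K']
  · rw [eq_top_iff, ← RKHS.kerFun_dense (RKHS.OfKernel K')]
    refine Submodule.topologicalClosure_mono (Submodule.span_le.2 ?_)
    rintro _ ⟨x, v, rfl⟩
    have : RKHS.kerFun (RKHS.OfKernel K') x v = v • RKHS.kerFun (RKHS.OfKernel K') x 1 := by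
      rw [← map_smul, smul_eq_mul, mul_one]
    rw [this]
    exact Submodule.smul_mem _ _ (Submodule.subset_span ⟨x, rfl⟩)

variable {H : Type*} [NormedAddCommGroup H] [InnerProductSpace ℂ H]

/-- Equal Gram matrices give equal norms of corresponding linear combinations, so the assignment is
well defined and isometric on a dense span. -/
theorem exists_clm_of_gram_eq [CompleteSpace H] {X : Type*} {Φ Ψ : X → H}
    (hΦ : (Submodule.span ℂ (Set.range Φ)).topologicalClosure = ⊤)
    (h : ∀ x y, inner ℂ (Ψ x) (Ψ y) = inner ℂ (Φ x) (Φ y)) :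
    ∃ T : H →L[ℂ] H, ∀ x, T (Φ x) = Ψ x := by
  have hd : DenseRange (Finsupp.linearCombination ℂ Φ) := by
    rw [DenseRange, ← LinearMap.coe_range, Finsupp.range_linearCombination]
    exact Submodule.dense_iff_topologicalClosure_eq_top.2 hΦ
  have hn : ∀ c : X →₀ ℂ,
      ‖Finsupp.linearCombination ℂ Ψ c‖ = ‖Finsupp.linearCombination ℂ Φ c‖ := fun c => by
    rw [← sq_eq_sq₀ (norm_nonneg _) (norm_nonneg _), ← inner_self_eq_norm_sq (𝕜 := ℂ),
      ← inner_self_eq_norm_sq (𝕜 := ℂ)]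
    simp only [Finsupp.linearCombination_apply, Finsupp.sum_inner, Finsupp.inner_sum,
      inner_smul_left, inner_smul_right, h]
  refine ⟨(Finsupp.linearCombination ℂ Ψ).extendOfNorm (Finsupp.linearCombination ℂ Φ),
    fun x => ?_⟩
  have := LinearMap.extendOfNorm_eq hd ⟨1, fun c => by rw [one_mul, hn]⟩ (Finsupp.single x 1)
  simpa using this

theorem ContinuousLinearMap.ext_of_span_dense {X : Type*} {Φ : X → H}
    (hΦ : (Submodule.span ℂ (Set.range Φ)).topologicalClosure = ⊤) {S T : H →L[ℂ] H}
    (h : ∀ x, S (Φ x) = T (Φ x)) : S = T :=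
  ContinuousLinearMap.ext_on (Submodule.dense_iff_topologicalClosure_eq_top.2 hΦ)
    (by rintro _ ⟨x, rfl⟩; exact h x)

theorem eq_zero_of_inner_span_dense [CompleteSpace H] {X : Type*} {Φ : X → H}
    (hΦ : (Submodule.span ℂ (Set.range Φ)).topologicalClosure = ⊤) {w : H}
    (h : ∀ x, inner ℂ (Φ x) w = 0) : w = 0 := by
  have hw : w ∈ (Submodule.span ℂ (Set.range Φ))ᗮ := by
    rw [Submodule.mem_orthogonal]
    intro u hu
    induction hu using Submodule.span_induction with
    | mem u hu => obtain ⟨x, rfl⟩ := hu; exact h x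
    | zero => simp
    | add u v _ _ hu hv => rw [inner_add_left, hu, hv, add_zero]
    | smul c u _ hu => rw [inner_smul_left, hu, mul_zero]
  rwa [Submodule.topologicalClosure_eq_top_iff.1 hΦ, Submodule.mem_bot] at hw

/-- An action on a total family of vectors that preserves the Gram matrix extends to a unitary
representation. -/
theorem exists_unitaryRep_of_gram [CompleteSpace H] {X G : Type*} [Group G] [MulAction G X]
    {Φ : X → H}
    (hΦ : (Submodule.span ℂ (Set.range Φ)).topologicalClosure = ⊤)
    (hinv : ∀ (g : G) x y, inner ℂ (Φ (g • x)) (Φ (g • y)) = inner ℂ (Φ x) (Φ y)) :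
    ∃ π : G →* unitary (H →L[ℂ] H), ∀ g x, (π g : H →L[ℂ] H) (Φ x) = Φ (g • x) := by
  choose T hT using fun g : G => exists_clm_of_gram_eq hΦ (hinv g)
  have hone : T 1 = 1 := ContinuousLinearMap.ext_of_span_dense hΦ fun x => by simp [hT]
  have hmul : ∀ g h, T (g * h) = T g * T h := fun g h =>
    ContinuousLinearMap.ext_of_span_dense hΦ fun x => by simp [hT, mul_smul]
  have hstar : ∀ g, star (T g) * T g = 1 := fun g => by
    refine ContinuousLinearMap.ext_of_span_dense hΦ fun y => ?_
    rw [← sub_eq_zero]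
    refine eq_zero_of_inner_span_dense hΦ fun x => ?_
    rw [inner_sub_right, ContinuousLinearMap.star_eq_adjoint, mul_apply_eq_comp,
      ContinuousLinearMap.adjoint_inner_right, hT, hT, hinv, one_apply_eq_self,
      sub_self]
  -- A left inverse of the invertible operator `T g` is its inverse `T g⁻¹`.
  have hstar' : ∀ g, star (T g) = T g⁻¹ := fun g => by
    calc star (T g) = star (T g) * (T g * T g⁻¹) := by
          rw [← hmul, mul_inv_cancel, hone, mul_one]
      _ = T g⁻¹ := by rw [← mul_assoc, hstar, one_mul]
  refine ⟨⟨⟨fun g => ⟨T g, ?_⟩, ?_⟩, ?_⟩, hT⟩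
  · rw [Unitary.mem_iff]
    exact ⟨hstar g, by rw [hstar', ← hmul, mul_inv_cancel, hone]⟩
  · exact Subtype.ext hone
  · exact fun g h => Subtype.ext (hmul g h)

/-- Strong continuity may be checked on a total family of vectors. -/
theorem continuous_unitaryRep_of_span_dense [CompleteSpace H] {X G : Type*} [Group G]
    [TopologicalSpace G]
    {Φ : X → H} (hΦ : (Submodule.span ℂ (Set.range Φ)).topologicalClosure = ⊤)
    (π : G →* unitary (H →L[ℂ] H))
    (h : ∀ x, Continuous fun g : G => (π g : H →L[ℂ] H) (Φ x)) (w : H) :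
    Continuous fun g : G => (π g : H →L[ℂ] H) w := by
  have hspan : ∀ u ∈ Submodule.span ℂ (Set.range Φ),
      Continuous fun g : G => (π g : H →L[ℂ] H) u := fun u hu => by
    induction hu using Submodule.span_induction with
    | mem u hu => obtain ⟨x, rfl⟩ := hu; exact h x
    | zero => simpa using continuous_const
    | add u v _ _ hu hv => simpa only [map_add] using! hu.add hv
    | smul c u _ hu => simpa only [map_smul] using! hu.const_smul c
  rw [continuous_iff_continuousAt]
  intro g
  rw [Metric.continuousAt_iff']
  intro ε hε
  obtain ⟨u, hu, hwu⟩ := (Submodule.dense_iff_topologicalClosure_eq_top.2 hΦ).exists_dist_lt w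
    (show 0 < ε / 3 by positivity)
  filter_upwards [Metric.continuousAt_iff'.1 (hspan u hu).continuousAt (ε / 3) (by positivity)]
    with g' hg'
  have hd : ∀ g : G, dist ((π g : H →L[ℂ] H) w) ((π g : H →L[ℂ] H) u) = dist w u := fun g => by
    rw [dist_eq_norm, ← map_sub, Unitary.norm_map, dist_eq_norm]
  calc _ ≤ dist ((π g' : H →L[ℂ] H) w) ((π g' : H →L[ℂ] H) u)
        + dist ((π g' : H →L[ℂ] H) u) ((π g : H →L[ℂ] H) u)
        + dist ((π g : H →L[ℂ] H) u) ((π g : H →L[ℂ] H) w) := dist_triangle4 _ _ _ _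
    _ < ε := by rw [hd, dist_comm ((π g : H →L[ℂ] H) u), hd]; linarith

/-- If `⟨Φ x, ψ i⟩ → 0` for a total family `Φ` and a bounded family `ψ`, then `ψ` tends weakly
to zero. -/
theorem tendsto_inner_zero_of_span_dense {X ι : Type*} {l : Filter ι} {Φ : X → H}
    (hΦ : (Submodule.span ℂ (Set.range Φ)).topologicalClosure = ⊤) {ψ : ι → H}
    (hψ : ∀ i, ‖ψ i‖ ≤ 1) (h : ∀ x, Tendsto (fun i => inner ℂ (Φ x) (ψ i)) l (𝓝 0)) (w : H) :
    Tendsto (fun i => inner ℂ w (ψ i)) l (𝓝 0) := by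
  have hspan : ∀ u ∈ Submodule.span ℂ (Set.range Φ),
      Tendsto (fun i => inner ℂ u (ψ i)) l (𝓝 0) := fun u hu => by
    induction hu using Submodule.span_induction with
    | mem u hu => obtain ⟨x, rfl⟩ := hu; exact h x
    | zero => simpa using tendsto_const_nhds
    | add u v _ _ hu hv => simpa [inner_add_left] using hu.add hv
    | smul c u _ hu => simpa [inner_smul_left] using hu.mul_const (starRingEnd ℂ c)
  rw [Metric.tendsto_nhds]
  intro ε hε
  obtain ⟨u, hu, hwu⟩ := (Submodule.dense_iff_topologicalClosure_eq_top.2 hΦ).exists_dist_lt w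
    (show 0 < ε / 2 by positivity)
  filter_upwards [Metric.tendsto_nhds.1 (hspan u hu) (ε / 2) (by positivity)] with i hi
  rw [dist_zero_right] at hi ⊢
  have h1 : inner ℂ w (ψ i) = inner ℂ (w - u) (ψ i) + inner ℂ u (ψ i) := by
    rw [← inner_add_left, sub_add_cancel]
  have h2 : ‖inner ℂ (w - u) (ψ i)‖ ≤ ‖w - u‖ * 1 :=
    (norm_inner_le_norm _ _).trans (by gcongr; exact hψ i)
  rw [dist_eq_norm] at hwu
  rw [h1]
  linarith [norm_add_le (inner ℂ (w - u) (ψ i)) (inner ℂ u (ψ i))]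

end UnitaryRep

/-- A topological group with continuous normalized positive definite functions that approximate `1`
uniformly on compact sets and that tend to zero, with all their left translates, along some
sequence does not have property (T). -/
theorem not_hasPropertyT_of_posSemidef.{u} {G : Type u} [Group G] [TopologicalSpace G]
    [IsTopologicalGroup G]
    (h : ∀ Q : Set G, IsCompact Q → ∀ ε : ℝ, 0 < ε → ∃ φ : G → ℝ, Continuous φ ∧ φ 1 = 1 ∧
      (Matrix.of fun g h : G => φ (g⁻¹ * h)).PosSemidef ∧ (∀ q ∈ Q, 1 - φ q < ε) ∧
      ∃ a : ℕ → G, ∀ g, Tendsto (fun i => φ (g * a i)) atTop (𝓝 0)) :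
    ¬ HasPropertyT G := by
  rintro ⟨Q, hQ, ε, hε, hT⟩
  -- The bound `ε² / 2` matches `‖Φ 1 - Φ q‖² = 2 (1 - φ q)`.
  obtain ⟨φ, hφc, hφ1, hφ, hφQ, a, ha⟩ := h Q hQ (ε ^ 2 / 2) (by positivity)
  obtain ⟨H, _, _, _, Φ, hin, hΦ⟩ := hφ.exists_gram
  simp only [Matrix.of_apply] at hin
  obtain ⟨π, hπ⟩ := exists_unitaryRep_of_gram (G := G) hΦ fun g x y => by
    rw [hin, hin, smul_eq_mul, smul_eq_mul, mul_inv_rev, mul_assoc, inv_mul_cancel_left]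
  have hnorm : ∀ g, ‖Φ g‖ = 1 := fun g => by
    have := inner_self_eq_norm_sq (𝕜 := ℂ) (Φ g)
    rw [hin, inv_mul_cancel, hφ1] at this
    rw [← sq_eq_sq₀ (norm_nonneg _) zero_le_one, ← this]
    simp
  have hsub : ∀ g g', ‖Φ g - Φ g'‖ ^ 2 = 2 * (1 - φ (g⁻¹ * g')) := fun g g' => by
    rw [norm_sub_sq (𝕜 := ℂ), hin, hnorm, hnorm]
    simp
    ring
  have hcont : Continuous Φ := by
    rw [continuous_iff_continuousAt]
    intro g
    rw [ContinuousAt, tendsto_iff_norm_sub_tendsto_zero]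
    have h1 : Tendsto (fun g' => √(2 * (1 - φ (g'⁻¹ * g)))) (𝓝 g)
        (𝓝 (√(2 * (1 - φ (g⁻¹ * g))))) :=
      Continuous.tendsto (f := fun g' => √(2 * (1 - φ (g'⁻¹ * g)))) (by fun_prop) g
    rw [inv_mul_cancel, hφ1, sub_self, mul_zero, Real.sqrt_zero] at h1
    refine h1.congr fun g' => ?_
    rw [← hsub, Real.sqrt_sq (norm_nonneg _)]
  have hΦ1 : Φ 1 ≠ 0 := fun h => by simpa [h] using hnorm 1
  obtain ⟨η, hη, hinv⟩ := hT H π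
    (continuous_unitaryRep_of_span_dense hΦ π fun x => by
      simp only [hπ, smul_eq_mul]
      fun_prop)
    ⟨Φ 1, hΦ1, fun q hq => by
      rw [hπ, smul_eq_mul, mul_one, hnorm, mul_one, ← sq_lt_sq₀ (norm_nonneg _) hε.le,
        norm_sub_rev, hsub, inv_one, one_mul]
      linarith [hφQ q hq]⟩
  -- An invariant `η` has the same inner product with every `Φ g`; the weak limit of `Φ (a i)` makes
  -- it `0`, so `η` is orthogonal to a total family.
  have hconst : ∀ g, inner ℂ η (Φ g) = inner ℂ η (Φ 1) := fun g => by
    have h1 : (π g : H →L[ℂ] H) (Φ 1) = Φ g := by rw [hπ, smul_eq_mul, mul_one]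
    rw [← h1]
    nth_rewrite 1 [← hinv g]
    exact Unitary.inner_map_map _ _ _
  have hlim := tendsto_inner_zero_of_span_dense (l := atTop) hΦ (fun i => (hnorm (a i)).le)
    (fun x => by
      simp only [hin]
      exact_mod_cast (Complex.continuous_ofReal.tendsto 0).comp (ha x⁻¹)) η
  simp only [hconst] at hlim
  have h0 := tendsto_nhds_unique hlim tendsto_const_nhds
  refine hη (eq_zero_of_inner_span_dense hΦ fun x => ?_)
  rw [← inner_conj_symm, hconst, ← h0, map_zero]

/-! ### The orbit kernel and the failure of property (T) -/

section OrbitKernel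

variable {n : ℕ}

namespace Hyperboloid

/-- With the upper bound that follows, `coshDist x y` is comparable to the time coordinate of `y`,
up to positive factors depending only on `x`; so escape to infinity does not depend on the base
point. -/
theorem mul_time_le_coshDist (x y : Hyperboloid n) :
    (x.1 0 - √(∑ i : Fin n, x.1 i.succ ^ 2)) * y.1 0 ≤ coshDist x y := by
  have h1 := (le_abs_self _).trans (abs_sum_mul_le x y)
  have h2 := mul_le_mul_of_nonneg_left y.sqrt_sum_sq_lt.le
    (Real.sqrt_nonneg (∑ i : Fin n, x.1 i.succ ^ 2))
  rw [coshDist, lorentzForm]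
  linarith

theorem coshDist_le_mul_time (x y : Hyperboloid n) : coshDist x y ≤ 2 * x.1 0 * y.1 0 := by
  have h := (abs_lt.1 (abs_kleinInner_lt_one x y)).1
  rw [coshDist_eq]
  nlinarith [mul_pos x.time_pos y.time_pos]

/-- A sequence that tends to infinity as seen from `o` does so as seen from every point. -/
theorem tendsto_coshDist_atTop {ι : Type*} {l : Filter ι} {y : ι → Hyperboloid n}
    (o x : Hyperboloid n) (h : Tendsto (fun i => coshDist o (y i)) l atTop) :
    Tendsto (fun i => coshDist x (y i)) l atTop := by
  have ho := o.time_pos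
  have hc : 0 < x.1 0 - √(∑ i : Fin n, x.1 i.succ ^ 2) := sub_pos.2 x.sqrt_sum_sq_lt
  refine tendsto_atTop_mono (fun i => ?_)
    (h.const_mul_atTop (show 0 < (x.1 0 - √(∑ i : Fin n, x.1 i.succ ^ 2)) / (2 * o.1 0) by
      positivity))
  refine le_trans ?_ (mul_time_le_coshDist x (y i))
  rw [div_mul_eq_mul_div, div_le_iff₀ (by positivity), mul_assoc]
  gcongr
  linarith [coshDist_le_mul_time o (y i)]

end Hyperboloid

open Hyperboloid

theorem IsUnitTangent.tendsto_coshDist_geodesic {o : Hyperboloid n} {v : Fin (n + 1) → ℝ}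
    (hv : IsUnitTangent o v) :
    Tendsto (fun i : ℕ => coshDist o (hv.geodesic i)) atTop atTop := by
  have h : ∀ i : ℕ, coshDist o (hv.geodesic i) = Real.cosh i := fun i => by
    rw [← cosh_hypDist]
    nth_rewrite 1 [← hv.geodesic_zero]
    rw [hv.isGeodesicLine_geodesic, Real.cosh_abs, zero_sub, Real.cosh_neg]
  simp only [h]
  refine tendsto_atTop_mono (fun i => ?_)
    ((Real.tendsto_exp_atTop.comp tendsto_natCast_atTop_atTop).atTop_div_const two_pos)
  rw [Real.cosh_eq, Function.comp_apply]
  linarith [Real.exp_pos (-(i : ℝ))]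

variable (G : Subgroup (lorentzO n)) (o : Hyperboloid n)

theorem continuous_coshDist_smul : Continuous fun g : G => coshDist o (g • o) := by
  have h1 : Continuous fun g : G => linAct (g : lorentzO n) o.1 := by
    have : Continuous fun g : G =>
        (((g : lorentzO n) : GL (Fin (n + 1)) ℝ) : Matrix (Fin (n + 1)) (Fin (n + 1)) ℝ) :=
      Units.continuous_val.comp (continuous_subtype_val.comp continuous_subtype_val)
    exact this.matrix_mulVec continuous_const
  refine ((continuous_lorentzForm_left o.1).comp h1).abs.congr fun g => ?_
  rw [coshDist_comm]
  exact (coshDist_smul_left (g : lorentzO n) o o).symm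

theorem orbitKernel_eq (g h : G) : orbitKernel G o g h = hypDist o ((g⁻¹ * h) • o) := by
  have := hypDist_smul_smul (g : lorentzO n) o ((g⁻¹ * h) • o)
  rw [← this]
  change _ = hypDist (g • o) (g • (g⁻¹ * h) • o)
  rw [smul_smul, mul_inv_cancel_left, orbitKernel]

theorem isGroupCNK_orbitKernel : IsGroupCNK (orbitKernel G o) := by
  refine ⟨isCNK_hypDist.comp fun g : G => g • o, fun g h k => ?_⟩
  rw [orbitKernel_eq, orbitKernel_eq, mul_inv_rev, mul_assoc, inv_mul_cancel_left]

/-- The positive definite function `g ↦ (cosh d(o, g o)) ^ (-s)` on `G`. -/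
theorem posSemidef_coshDist_smul_rpow {s : ℝ} (hs : 0 ≤ s) :
    (Matrix.of fun g h : G => coshDist o ((g⁻¹ * h) • o) ^ (-s)).PosSemidef := by
  convert (posSemidef_coshDist_rpow (n := n) hs).submatrix fun g : G => g • o using 1
  ext g h
  have := coshDist_smul_smul (g : lorentzO n) o ((g⁻¹ * h) • o)
  rw [Matrix.of_apply, ← this]
  change coshDist (g • o) (g • (g⁻¹ * h) • o) ^ (-s) = _
  rw [smul_smul, mul_inv_cancel_left]
  rfl

/-- On `[1, C]` the minimum of `u ^ (-s)` is `C ^ (-s)`, which tends to `1` as `s → 0⁺`. -/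
theorem exists_rpow_neg_gt {C δ : ℝ} (hC : 1 ≤ C) (hδ : 0 < δ) :
    ∃ s : ℝ, 0 < s ∧ ∀ u, 1 ≤ u → u ≤ C → 1 - u ^ (-s) < δ := by
  have hc : Tendsto (fun s : ℝ => C ^ (-s)) (𝓝[>] 0) (𝓝 1) := by
    have : ContinuousAt (fun s : ℝ => C ^ (-s)) 0 :=
      (Real.continuousAt_const_rpow (by linarith)).comp continuousAt_neg
    simpa using this.tendsto.mono_left nhdsWithin_le_nhds
  obtain ⟨s, hs, hs0⟩ := ((hc.eventually (lt_mem_nhds (show 1 - δ < 1 by linarith))).and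
    self_mem_nhdsWithin).exists
  have hs0 : 0 < s := hs0
  refine ⟨s, hs0, fun u h1 hu => ?_⟩
  have := Real.rpow_le_rpow_of_nonpos (z := -s) (by linarith) hu (by linarith)
  linarith

theorem not_hasPropertyT_of_tendsto (a : ℕ → G)
    (ha : Tendsto (fun i => coshDist o (a i • o)) atTop atTop) : ¬ HasPropertyT G := by
  refine not_hasPropertyT_of_posSemidef fun Q hQ ε hε => ?_
  have hcont := continuous_coshDist_smul G o
  obtain ⟨C, hC⟩ := (hQ.image hcont).bddAbove
  -- The maximum with `1` covers an empty `Q`, for which `C` is arbitrary.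
  obtain ⟨s, hs, hsC⟩ := exists_rpow_neg_gt (le_max_right C 1) hε
  refine ⟨fun g => coshDist o (g • o) ^ (-s),
    hcont.rpow_const fun g => Or.inl (coshDist_pos _ _).ne', ?_,
    posSemidef_coshDist_smul_rpow G o hs.le, fun q hq => ?_, a, fun g => ?_⟩
  · simp only [one_smul, coshDist_self, Real.one_rpow]
  · exact hsC _ (one_le_coshDist _ _) ((hC ⟨q, hq, rfl⟩).trans (le_max_left _ _))
  -- By invariance, translating by `g` amounts to moving the base point to `g⁻¹ o`.
  · refine ((tendsto_rpow_neg_atTop hs).comp (tendsto_coshDist_atTop o (g⁻¹ • o) ha)).congr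
      fun i => ?_
    have := coshDist_smul_smul (g : lorentzO n) (g⁻¹ • o) (a i • o)
    rw [Function.comp_apply, ← this]
    change coshDist (g • g⁻¹ • o) (g • a i • o) ^ (-s) = _
    rw [smul_inv_smul, smul_smul]

end OrbitKernel

theorem mainTheorem3 (n : ℕ) (hn : 1 ≤ n) (G : Subgroup (lorentzO n))
    (hG : G = lorentzSO n ∨ G = lorentzSO0 n ∨ G = lorentzOPlus n) (o : Hyperboloid n) :
    (∀ g h : G, orbitKernel G o g h = hypDist o ((g⁻¹ * h) • o)) ∧
    IsGroupCNK (orbitKernel G o) ∧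
    (∃ p : ℝ → Hyperboloid n, IsGeodesicLine p ∧ p 0 = o) ∧
    (∀ p : ℝ → Hyperboloid n, IsGeodesicLine p → p 0 = o →
      ∃ a : Multiplicative ℝ →* G, Continuous a ∧ IsTranslationAlong p a ∧
        (∀ t : ℝ, orbitKernel G o (a (Multiplicative.ofAdd t)) 1 = |t|) ∧
        Tendsto (fun t : ℝ => orbitKernel G o (a (Multiplicative.ofAdd t)) 1) atTop atTop) ∧
    ¬ IsBoundedKernel (orbitKernel G o) ∧
    ¬ HasPropertyT G := by
  have hle : lorentzSO0 n ≤ G := by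
    rcases hG with rfl | rfl | rfl
    · exact inf_le_left
    · exact le_rfl
    · exact inf_le_right
  have hK : ∀ {v} (hv : IsUnitTangent o v) (t : ℝ),
      orbitKernel G o (hv.boostHom hle (Multiplicative.ofAdd t)) 1 = |t| := fun hv t => by
    have h := hv.isGeodesicLine_geodesic t 0
    rw [orbitKernel, one_smul]
    rwa [hv.geodesic_zero, sub_zero, ← hv.boostHom_smul hle] at h
  obtain ⟨v, hv⟩ := exists_isUnitTangent hn o
  refine ⟨orbitKernel_eq G o, isGroupCNK_orbitKernel G o,
    ⟨hv.geodesic, hv.isGeodesicLine_geodesic, hv.geodesic_zero⟩, fun p hp hp0 => ?_, ?_, ?_⟩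
  · subst hp0
    obtain ⟨w, hw, hpw⟩ := hp.exists_eq_geodesicVec
    refine ⟨hw.boostHom hle, hw.continuous_boostHom hle,
      hw.isTranslationAlong_boostHom (funext fun t => Subtype.ext (hpw t)) hle, hK hw, ?_⟩
    simpa only [hK hw] using tendsto_abs_atTop_atTop
  · rintro ⟨C, hC⟩
    have := hC (hv.boostHom hle (Multiplicative.ofAdd (|C| + 1))) 1
    rw [hK, abs_abs, abs_of_pos (by positivity)] at this
    linarith [le_abs_self C]
  · refine not_hasPropertyT_of_tendsto G o (fun i => hv.boostHom hle (Multiplicative.ofAdd (i : ℝ)))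
      ?_
    simpa only [hv.boostHom_smul] using hv.tendsto_coshDist_geodesic
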